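/- **Theorem 1.3.** A well-ordering $\prec$ of a topological space $X$ is *left-separating* if $\{y\in X: y\prec x\}$ is closed in $X$ for every $x\in X$; $X$ is *left-separated* if it has a left-separating well-ordering, and then its *left-separating type* $\operatorname{ord}_\ell(X)$ is the minimum of the order types of the left-separating well-orderings of $X$. A space is *locally countable* if every point has a countable neighbourhood, and *0-dimensional* if it is Hausdorff and has a base of clopen sets. Let $\kappa=2^{\omega}$, or let $\kappa=\beth_{\beta+1}$ for some ordinal $\beta$ with $\operatorname{cf}(\beta)=\omega$ (here $\beth_0=\omega$, $\beth_{\gamma+1}=2^{\beth_\gamma}$, and $\beth_\gamma=\sup_{\delta<\gamma}\beth_\delta$ for limit $\gamma$). Then for every ordinal $\alpha<\kappa^+$ there is a locally compact, locally countable, 0-dimensional space $X$ which is left-separated and satisfies $\operatorname{ord}_\ell(X)=\kappa\cdot\alpha$, where $\cdot$ is ordinal multiplication (for $\alpha=0$ the space $X$ is empty). -/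

import Mathlib

open Cardinal Ordinal

universe u

/-- A relation on a topological space is a *left-separating well-ordering* if it is a (strict)
well-ordering of the points all of whose proper initial segments `{y | y ≺ x}` are closed. -/
structure IsLeftSeparating {X : Type u} [TopologicalSpace X] (r : X → X → Prop) : Prop where
  isWellOrder : IsWellOrder X r
  isClosed_initial : ∀ x : X, IsClosed {y : X | r y x}

/-- A space is *left-separated* if it has a left-separating well-ordering. -/
def IsLeftSeparated (X : Type u) [TopologicalSpace X] : Prop :=
  ∃ r : X → X → Prop, IsLeftSeparating r

/-- The set of order types of the left-separating well-orderings of `X`. -/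
def leftSeparatingTypes (X : Type u) [TopologicalSpace X] : Set Ordinal.{u} :=
  {o | ∃ (r : X → X → Prop) (h : IsLeftSeparating r), o = @Ordinal.type X r h.isWellOrder}

/-- The *left-separating type* of `X`: the minimum of the order types of the left-separating
well-orderings of `X`. It is only meaningful when `X` is left-separated. -/
noncomputable def leftSeparatingType (X : Type u) [TopologicalSpace X] : Ordinal.{u} :=
  sInf (leftSeparatingTypes X)

/-- A space is *locally countable* if every point has a countable neighbourhood. -/
def LocallyCountable (X : Type u) [TopologicalSpace X] : Prop :=
  ∀ x : X, ∃ U ∈ nhds x, U.Countable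

/-- A space is *zero-dimensional* if it is Hausdorff and its clopen sets form a base. -/
structure IsZeroDimensional (X : Type u) [TopologicalSpace X] : Prop where
  t2 : T2Space X
  isTopologicalBasis_isClopen : TopologicalSpace.IsTopologicalBasis {U : Set X | IsClopen U}

/-! Here `κ = 2 ^ λ = λ ^ ℵ₀` for some infinite `λ`, so `λ < cf κ`, and `Λ ^ ω` has `κ` points when
`#Λ = λ`. The space injects into `Λ ^ ω` and is split into levels below `α`, with `κ` points each.
Every point is isolated or the limit of a sequence of points of higher level. Ordering by level, and
within a level by an enumeration in type at most `κ`, is thus left-separating, of type at most `κ *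
α` (`exists_isLeftSeparating_type_le`).

For the lower bound, `exists_leveled_space` ensures that any `κ` points of level `β` include at most
`λ` whose closure has `κ` points in each level `γ < β`. As initial segments are closed and `λ < cf
κ`, induction on `β` shows that fewer than `κ` points of level `β` occupy positions below `κ * β`
(`mk_level_inter_lt`). An order of type below `κ * α` would then have no room for some level
(`ord_mul_le_type`). -/

/-- `Cone R k m j` means that `j` is reached from `k` by finitely many `R`-steps whose indices are
weakly increasing and at least `m`. -/
inductive Cone {K : Type u} (R : K → ℕ → K → Prop) : K → ℕ → K → Prop
  | refl (k : K) (m : ℕ) : Cone R k m k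
  | step {k k' j : K} {m n : ℕ} : m ≤ n → R k n k' → Cone R k' n j → Cone R k m j

/-! ### The topology generated by cones -/

namespace Cone

variable {K : Type u} {R : K → ℕ → K → Prop}

theorem anti {k j : K} {m m' : ℕ} (h : Cone R k m j) (hm : m' ≤ m) : Cone R k m' j := by
  cases h with
  | refl => exact .refl _ _
  | step h₁ h₂ h₃ => exact .step (hm.trans h₁) h₂ h₃

theorem exists_forall {k j : K} {m : ℕ} (h : Cone R k m j) :
    ∃ m', ∀ i, Cone R j m' i → Cone R k m i := by
  induction h with
  | refl k m => exact ⟨m, fun _ h ↦ h⟩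
  | step h₁ h₂ _ ih =>
    obtain ⟨m', hm'⟩ := ih
    exact ⟨m', fun i hi ↦ .step h₁ h₂ (hm' i hi)⟩

/-- Since indices never decrease along a path, no step disturbs the coordinates below `m`. This
separates distinct points by disjoint cones. -/
theorem agree {Λ : Type*} {z : K → ℕ → Λ} (hz : ∀ k n k', R k n k' → ∀ i < n, z k i = z k' i)
    {k j : K} {m : ℕ} (h : Cone R k m j) : ∀ i < m, z k i = z j i := by
  induction h with
  | refl k m => exact fun _ _ ↦ rfl
  | step h₁ h₂ _ ih =>
    exact fun i hi ↦ (hz _ _ _ h₂ i (hi.trans_le h₁)).trans (ih i (hi.trans_le h₁))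

theorem eq_or_lt {ℓ : K → Ordinal.{u}} (hℓ : ∀ k n k', R k n k' → ℓ k < ℓ k')
    {k j : K} {m : ℕ} (h : Cone R k m j) : j = k ∨ ℓ k < ℓ j := by
  induction h with
  | refl k m => exact .inl rfl
  | step _ h₂ _ ih =>
    right
    rcases ih with rfl | ih
    · exact hℓ _ _ _ h₂
    · exact (hℓ _ _ _ h₂).trans ih

/-- The topology in which the sets `{j | Cone R k m j}` form a neighbourhood base at `k`. -/
@[reducible] def topology (R : K → ℕ → K → Prop) : TopologicalSpace K where
  IsOpen U := ∀ k ∈ U, ∃ m, ∀ j, Cone R k m j → j ∈ U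
  isOpen_univ := fun _ _ ↦ ⟨0, fun _ _ ↦ trivial⟩
  isOpen_inter := by
    intro s t hs ht k hk
    obtain ⟨m, hm⟩ := hs k hk.1
    obtain ⟨m', hm'⟩ := ht k hk.2
    exact ⟨max m m', fun j hj ↦
      ⟨hm j (hj.anti (le_max_left _ _)), hm' j (hj.anti (le_max_right _ _))⟩⟩
  isOpen_sUnion := by
    intro S hS k hk
    obtain ⟨s, hs, hks⟩ := hk
    obtain ⟨m, hm⟩ := hS s hs k hks
    exact ⟨m, fun j hj ↦ ⟨s, hs, hm j hj⟩⟩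

theorem isOpen_cone (k : K) (m : ℕ) : @IsOpen K (topology R) {j | Cone R k m j} :=
  fun _ hj ↦ exists_forall hj

theorem mem_nhds_iff {k : K} {U : Set K} :
    U ∈ @nhds K (topology R) k ↔ ∃ m, ∀ j, Cone R k m j → j ∈ U := by
  let := topology R
  rw [_root_.mem_nhds_iff]
  constructor
  · rintro ⟨V, hVU, hV, hk⟩
    obtain ⟨m, hm⟩ := hV k hk
    exact ⟨m, fun j hj ↦ hVU (hm j hj)⟩
  · rintro ⟨m, hm⟩
    exact ⟨_, hm, isOpen_cone k m, .refl _ _⟩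

/-- Induction on `e`: the cover member containing `k` swallows all branches of large index. Finitely
many branches remain, each empty or a cone at a point of smaller `e`. -/
theorem isCompact_cone {e : K → Ordinal.{u}} (he : ∀ k n k', R k n k' → e k' < e k)
    (hfun : ∀ k n a b, R k n a → R k n b → a = b) (k : K) (m : ℕ) :
    @IsCompact K (topology R) {j | Cone R k m j} := by
  let := topology R
  induction hk : e k using WellFoundedLT.induction generalizing k m with
  | ind o ih =>
  subst hk
  have hT : ∀ n, IsCompact {j | ∃ k', R k n k' ∧ Cone R k' n j} := by
    intro n
    by_cases h : ∃ k', R k n k'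
    · obtain ⟨k', hk'⟩ := h
      convert ih (e k') (he _ _ _ hk') k' n rfl using 1
      ext j
      constructor
      · rintro ⟨a, ha, hj⟩
        rwa [hfun _ _ _ _ ha hk'] at hj
      · exact fun hj ↦ ⟨k', hk', hj⟩
    · convert isCompact_empty
      ext j
      simp only [Set.mem_ofPred_eq, Set.mem_empty_iff_false, iff_false]
      rintro ⟨k', hk', -⟩
      exact h ⟨k', hk'⟩
  refine isCompact_of_finite_subcover fun {ι} U hU hcov ↦ ?_
  obtain ⟨i₀, hi₀⟩ := Set.mem_iUnion.1 (hcov (Cone.refl k m))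
  obtain ⟨m', hm'⟩ := hU i₀ k hi₀
  have hc : IsCompact (⋃ n ∈ Finset.Ico m m', {j | ∃ k', R k n k' ∧ Cone R k' n j}) :=
    (Finset.Ico m m').isCompact_biUnion fun n _ ↦ hT n
  obtain ⟨t, ht⟩ := hc.elim_finite_subcover U hU (by
    refine Set.Subset.trans ?_ hcov
    simp only [Set.iUnion_subset_iff]
    rintro n hn j ⟨k', hk', hj⟩
    exact Cone.step (Finset.mem_Ico.1 hn).1 hk' hj)
  classical
  refine ⟨insert i₀ t, fun j hj ↦ ?_⟩
  simp only [Finset.mem_insert, Set.iUnion_iUnion_eq_or_left, Set.mem_union]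
  cases hj with
  | refl => exact .inl hi₀
  | @step _ k' _ _ n h₁ h₂ h₃ =>
    by_cases hn : m' ≤ n
    · exact .inl (hm' _ (.step hn h₂ h₃))
    · refine .inr (ht ?_)
      simp only [Set.mem_iUnion]
      exact ⟨n, Finset.mem_Ico.2 ⟨h₁, not_le.1 hn⟩, k', h₂, h₃⟩

theorem countable_cone {e : K → Ordinal.{u}} (he : ∀ k n k', R k n k' → e k' < e k)
    (hfun : ∀ k n a b, R k n a → R k n b → a = b) (k : K) (m : ℕ) :
    {j | Cone R k m j}.Countable := by
  induction hk : e k using WellFoundedLT.induction generalizing k m with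
  | ind o ih =>
  subst hk
  have hT : ∀ n, {j | ∃ k', R k n k' ∧ Cone R k' n j}.Countable := by
    intro n
    have : {j | ∃ k', R k n k' ∧ Cone R k' n j} =
        ⋃ k' ∈ {k' | R k n k'}, {j | Cone R k' n j} := by
      ext j; simp
    rw [this]
    refine Set.Countable.biUnion ?_ fun k' hk' ↦ ih (e k') (he _ _ _ hk') k' n rfl
    exact Set.Subsingleton.countable fun a ha b hb ↦ hfun _ _ _ _ ha hb
  refine ((Set.countable_singleton k).union (Set.countable_iUnion hT)).mono fun j hj ↦ ?_
  cases hj with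
  | refl => exact .inl rfl
  | @step _ k' _ _ n h₁ h₂ h₃ => exact .inr (Set.mem_iUnion.2 ⟨n, k', h₂, h₃⟩)

theorem exists_topology {Λ : Type*} {z : K → ℕ → Λ} {e ℓ : K → Ordinal.{u}}
    (hz : Function.Injective z) (hRz : ∀ k n k', R k n k' → ∀ i < n, z k i = z k' i)
    (he : ∀ k n k', R k n k' → e k' < e k) (hℓ : ∀ k n k', R k n k' → ℓ k < ℓ k')
    (hfun : ∀ k n a b, R k n a → R k n b → a = b) :
    ∃ _ : TopologicalSpace K, LocallyCompactSpace K ∧ LocallyCountable K ∧ IsZeroDimensional K ∧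
      (∀ k, ∀ᶠ j in nhds k, j = k ∨ ℓ k < ℓ j) ∧
      ∀ k (s : Set K), (∀ n, ∃ k' ∈ s, R k n k') → k ∈ closure s := by
  let := topology R
  have hnhds (k : K) (m : ℕ) : {j | Cone R k m j} ∈ nhds k := mem_nhds_iff.2 ⟨m, fun _ h ↦ h⟩
  have hT2 : T2Space K := by
    refine ⟨fun x y hxy ↦ ?_⟩
    obtain ⟨n, hn⟩ := Function.ne_iff.1 (hz.ne hxy)
    refine ⟨_, _, isOpen_cone x (n + 1), isOpen_cone y (n + 1), Cone.refl _ _, Cone.refl _ _, ?_⟩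
    rw [Set.disjoint_left]
    intro j hj hj'
    exact hn ((agree hRz hj n n.lt_succ_self).trans (agree hRz hj' n n.lt_succ_self).symm)
  refine ⟨inferInstance, ⟨fun x U hU ↦ ?_⟩, fun x ↦ ⟨_, hnhds x 0, countable_cone he hfun x 0⟩,
    ⟨hT2, ?_⟩, fun k ↦ ?_, fun k s hs ↦ ?_⟩
  · obtain ⟨m, hm⟩ := mem_nhds_iff.1 hU
    exact ⟨_, hnhds x m, hm, isCompact_cone he hfun x m⟩
  · refine TopologicalSpace.isTopologicalBasis_of_isOpen_of_nhds (fun U hU ↦ hU.isOpen)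
      fun x U hx hU ↦ ?_
    obtain ⟨m, hm⟩ := hU x hx
    exact ⟨_, ⟨(isCompact_cone he hfun x m).isClosed, isOpen_cone x m⟩, Cone.refl _ _, hm⟩
  · exact Filter.mem_of_superset (hnhds k 0) fun j hj ↦ eq_or_lt hℓ hj
  · rw [mem_closure_iff_nhds]
    intro U hU
    obtain ⟨m, hm⟩ := mem_nhds_iff.1 hU
    obtain ⟨k', hk', hR⟩ := hs m
    exact ⟨k', hm _ (.step le_rfl hR (.refl _ _)), hk'⟩

end Cone

/-! ### Cardinal arithmetic and selection lemmas -/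

theorem Cardinal.IsStrongLimit.power_cof_ord {c : Cardinal.{u}} (hc : c.IsStrongLimit) :
    c ^ c.ord.cof = 2 ^ c := by
  apply le_antisymm
  · calc c ^ c.ord.cof ≤ c ^ c := power_le_power_left hc.ne_zero (cof_ord_le c)
      _ = 2 ^ c := power_self_eq hc.aleph0_le
  induction c using Cardinal.inductionOn with | mk Λ
  obtain ⟨_, _, hΛ⟩ := exists_ord_eq_type_lt Λ
  have : NoMaxOrder Λ := by
    rw [← isSuccPrelimit_type_lt_iff, ← hΛ]
    exact (isSuccLimit_ord hc.aleph0_le).isSuccPrelimit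
  obtain ⟨s, hs, hs'⟩ := Order.exists_cof_eq Λ
  have hB := mk_bounded_subset (α := Λ) hc.isStrongPrelimit (r := (· < ·)) hΛ
  rw [hΛ, cof_type, ← hs', ← mk_set]
  conv_rhs => rw [← hB, power_def]
  -- A set is determined by its traces below the members of a cofinal set, and there are only `c`
  -- bounded sets.
  refine mk_le_of_injective (f := fun (t : Set Λ) (i : s) ↦
    (⟨t ∩ Set.Iio i.1, i.1, fun x hx ↦ hx.2⟩ : {t : Set Λ // Set.Bounded (· < ·) t})) ?_
  intro t t' h
  ext x
  obtain ⟨y, hxy⟩ := exists_gt x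
  obtain ⟨i, hi, hyi⟩ := hs y
  have := congrArg Subtype.val (congrFun h ⟨i, hi⟩)
  have := Set.ext_iff.1 this x
  simpa [hxy.trans_le hyi] using this

theorem mk_setOf_mem_Ico_le {K : Type u} {f : K → Ordinal.{u}} (hf : Function.Injective f)
    (a b : Ordinal.{u}) : #{k | a ≤ f k ∧ f k < a + b} ≤ b.card := by
  rw [← mk_toType b]
  refine mk_le_of_injective (f := fun k ↦ ToType.mk ⟨f k.1 - a, ?_⟩) ?_
  · exact (Ordinal.sub_lt_of_le k.2.1).2 k.2.2
  · intro k k' h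
    have h := congrArg Subtype.val (ToType.mk.injective h)
    apply Subtype.ext
    apply hf
    rw [← Ordinal.add_sub_cancel_of_le k.2.1, ← Ordinal.add_sub_cancel_of_le k'.2.1]
    exact congrArg (a + ·) h

theorem mk_setOf_lt_le {K : Type u} {f : K → Ordinal.{u}} (hf : Function.Injective f)
    (b : Ordinal.{u}) : #{k | f k < b} ≤ b.card := by
  simpa using mk_setOf_mem_Ico_le hf 0 b

theorem le_mk_setOf_of_mk_setOf_not_lt {K : Type u} {κ : Cardinal.{u}} (hκ : ℵ₀ ≤ κ) (hK : κ ≤ #K)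
    {P : K → Prop} (hP : #{k | ¬ P k} < κ) : κ ≤ #{k | P k} := by
  by_contra! h
  have := mk_sum_compl {k | P k}
  exact (hK.trans_eq this.symm).not_gt (add_lt_of_lt hκ h hP)

theorem exists_injective_lt_ord {K : Type u} {κ : Cardinal.{u}} (hK : #K ≤ κ) :
    ∃ e : K → Ordinal.{u}, Function.Injective e ∧ ∀ k, e k < κ.ord := by
  rw [← mk_ord_toType κ] at hK
  obtain ⟨f⟩ := hK
  exact ⟨fun k ↦ (f k).toOrd, fun _ _ h ↦ f.injective (ToType.mk.symm.injective (Subtype.ext h)),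
    fun k ↦ (f k).toOrd.2⟩

/-- Transfinite recursion along an enumeration of type at most `κ.ord`: fewer than `κ` values are
taken at each stage. -/
theorem exists_injective_forall_mem {K M : Type u} {κ : Cardinal.{u}} (hK : #K ≤ κ)
    {F : K → Set M} (hF : ∀ k, κ ≤ #(F k)) :
    ∃ z : K → M, Function.Injective z ∧ ∀ k, z k ∈ F k := by
  rcases isEmpty_or_nonempty K with hE | ⟨⟨k₀⟩⟩
  · exact ⟨hE.elim, hE.elim, fun k ↦ hE.elim k⟩
  have : Nonempty M := by
    have h0 : κ ≠ 0 := fun h ↦ by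
      rw [h, nonpos_iff_eq_zero, mk_eq_zero_iff] at hK
      exact hK.elim k₀
    have : #(F k₀) ≠ 0 := fun h ↦ h0 (nonpos_iff_eq_zero.1 (h ▸ hF k₀))
    exact (mk_ne_zero_iff.1 this).map Subtype.val
  obtain ⟨e, he, heκ⟩ := exists_injective_lt_ord hK
  have wf : WellFounded fun k k' ↦ e k < e k' := InvImage.wf e wellFounded_lt
  let z : K → M := wf.fix fun k ih ↦
    Classical.epsilon fun x ↦ x ∈ F k ∧ ∀ k' (h : e k' < e k), ih k' h ≠ x
  have hz : ∀ k, z k ∈ F k ∧ ∀ k', e k' < e k → z k' ≠ z k := by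
    intro k
    have key : ∃ x, x ∈ F k ∧ ∀ k' (_ : e k' < e k), z k' ≠ x := by
      by_contra! h
      have h1 : F k ⊆ z '' {k' | e k' < e k} := fun x hx ↦ by
        obtain ⟨k', hk', h⟩ := h x hx
        exact ⟨k', hk', h⟩
      have h2 := (hF k).trans <| (mk_le_mk_of_subset h1).trans <| mk_image_le.trans
        (mk_setOf_lt_le he (e k))
      exact h2.not_gt (lt_ord.1 (heκ k))
    have h3 : z k = Classical.epsilon fun x ↦ x ∈ F k ∧ ∀ k' (_ : e k' < e k), z k' ≠ x :=
      wf.fix_eq _ k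
    rw [h3]
    exact Classical.epsilon_spec key
  refine ⟨z, fun a b hab ↦ ?_, fun k ↦ (hz k).1⟩
  rcases lt_trichotomy (e a) (e b) with h | h | h
  · exact ((hz b).2 a h hab).elim
  · exact he h
  · exact ((hz a).2 b h hab.symm).elim

/-- Either some `d ∈ A` has `κ` predecessors in `A`, which then serve as `B`, or all have fewer, and
`λ < cf κ` stops a set of size `λ` from being cofinal in `A`. -/
theorem exists_subset_forall_bounded {K : Type u} {κ lam : Cardinal.{u}} (hκ : ℵ₀ ≤ κ)
    (hlam : lam < κ.ord.cof) (p : K → Ordinal.{u}) {A : Set K} (hA : κ ≤ #A) :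
    ∃ B ⊆ A, κ ≤ #B ∧ ∀ c ⊆ B, #c ≤ lam → ∃ d ∈ A, ∀ x ∈ c, p x ≤ p d := by
  by_cases h : ∃ d ∈ A, κ ≤ #{x | x ∈ A ∧ p x < p d}
  · obtain ⟨d, hd, h⟩ := h
    exact ⟨_, fun x hx ↦ hx.1, h, fun c hc _ ↦ ⟨d, hd, fun x hx ↦ (hc hx).2.le⟩⟩
  push Not at h
  refine ⟨A, subset_rfl, hA, fun c hc hcl ↦ ?_⟩
  by_contra! hd
  have hsub : A ⊆ ⋃ x : c, {y | y ∈ A ∧ p y < p x} := fun y hy ↦ by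
    obtain ⟨x, hx, hyx⟩ := hd y hy
    exact Set.mem_iUnion.2 ⟨⟨x, hx⟩, hy, hyx⟩
  refine hA.not_gt ((mk_le_mk_of_subset hsub).trans_lt ((mk_iUnion_le _).trans_lt ?_))
  have hcκ := hcl.trans_lt hlam
  exact mul_lt_of_lt hκ (hcκ.trans_le (cof_ord_le κ))
    (iSup_lt_of_lt_cof_ord hcκ fun x ↦ h x (hc x.2))

/-- One representative for each finite word over `Λ` that begins some `z x` with `x ∈ A`. -/
theorem exists_subset_mk_le_agree {K Λ : Type u} [Infinite Λ] (z : K → ℕ → Λ) (A : Set K) :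
    ∃ c ⊆ A, #c ≤ #Λ ∧ ∀ x ∈ A, ∀ n, ∃ y ∈ c, ∀ i < n, z x i = z y i := by
  let T := {l : List Λ // ∃ x ∈ A, ∃ n, (List.range n).map (z x) = l}
  choose g hg n hn using fun l : T ↦ l.2
  refine ⟨Set.range g, Set.range_subset_iff.2 hg,
    mk_range_le.trans ((mk_subtype_le _).trans (mk_list_eq_mk Λ).le), fun x hx m ↦ ?_⟩
  let l : T := ⟨(List.range m).map (z x), x, hx, m, rfl⟩
  refine ⟨g l, ⟨l, rfl⟩, fun i hi ↦ ?_⟩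
  have h : (List.range (n l)).map (z (g l)) = (List.range m).map (z x) := hn l
  have hlen : n l = m := by simpa using congrArg List.length h
  rw [hlen, List.map_inj_left] at h
  exact (h i (List.mem_range.2 hi)).symm

/-! ### Construction of the leveled space -/

theorem exists_leveled_space {Λ : Type u} [Infinite Λ] {κ : Cardinal.{u}} (hκ : κ = 2 ^ #Λ)
    (hΛ : #Λ ^ ℵ₀ = κ) {α : Ordinal.{u}} (hα : α.card ≤ κ) :
    ∃ (K : Type u) (_ : TopologicalSpace K) (ℓ : K → Ordinal.{u}),
      (LocallyCompactSpace K ∧ LocallyCountable K ∧ IsZeroDimensional K) ∧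
      (∀ k, ∀ᶠ j in nhds k, j = k ∨ ℓ k < ℓ j) ∧ (∀ k, ℓ k < α) ∧ #K ≤ κ ∧
      (∀ γ < α, κ ≤ #{k | ℓ k = γ}) ∧
      ∀ β, ∀ A : Set K, (∀ k ∈ A, ℓ k = β) → κ ≤ #A →
        ∃ c ⊆ A, #c ≤ #Λ ∧ ∀ γ < β, κ ≤ #{k | k ∈ closure c ∧ ℓ k = γ} := by
  have hΛκ : #Λ < κ := hκ ▸ cantor _
  have hωΛ : ℵ₀ ≤ #Λ := aleph0_le_mk Λ
  have hωκ : ℵ₀ ≤ κ := hωΛ.trans hΛκ.le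
  have hcof : #Λ < κ.ord.cof := hκ ▸ lt_cof_ord_power hωΛ one_lt_two
  have hM : #(ℕ → Λ) = κ := by rw [← hΛ]; simp
  let cl : Set (ℕ → Λ) → Set (ℕ → Λ) := fun c ↦ {x | ∀ n, ∃ y ∈ c, ∀ i < n, x i = y i}
  -- All small sets with large metric closure. Each is assigned to `κ` points on every level, as a
  -- prospective source of sequences converging to them.
  let C := {c : Set (ℕ → Λ) // #c ≤ #Λ ∧ κ ≤ #(cl c)}
  have hC : #C ≤ κ := by
    have h1 : #C ≤ #{c : Set (ℕ → Λ) // #c ≤ #Λ} :=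
      mk_le_of_injective (f := fun c ↦ ⟨c.1, c.2.1⟩) fun c c' h ↦
        Subtype.ext (Subtype.mk.inj h)
    refine h1.trans ((mk_bounded_set_le _ _).trans ?_)
    rw [hM, max_eq_left hωκ, hκ, ← power_mul, mul_eq_self hωΛ]
  let ι := κ.ord.ToType
  have hι : #ι = κ := mk_ord_toType κ
  let K := α.ToType × C × ι
  have hK : #K ≤ κ := by
    simp only [K, mk_prod, Cardinal.lift_id, mk_toType, hι]
    exact mul_le_of_le hωκ hα (mul_le_of_le hωκ hC le_rfl)
  obtain ⟨z, hz, hzcl⟩ := exists_injective_forall_mem hK (F := fun k : K ↦ cl k.2.1.1)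
    fun k ↦ k.2.1.2.2
  obtain ⟨e, he, heκ⟩ := exists_injective_lt_ord hK
  let ℓ : K → Ordinal.{u} := fun k ↦ k.1.toOrd
  -- The points whose assigned set lies on higher levels and earlier in `e`; all others are made
  -- isolated.
  let G : K → Prop := fun k ↦ ∀ x ∈ k.2.1.1, ∃ k', z k' = x ∧ ℓ k < ℓ k' ∧ e k' < e k
  have hs : ∀ k : {k // G k}, ∀ n : ℕ, ∃ k', z k' ∈ k.1.2.1.1 ∧ (∀ i < n, z k.1 i = z k' i) ∧
      ℓ k.1 < ℓ k' ∧ e k' < e k.1 := by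
    rintro ⟨k, hk⟩ n
    obtain ⟨x, hx, hxn⟩ := hzcl k n
    obtain ⟨k', rfl, h⟩ := hk x hx
    exact ⟨k', hx, hxn, h⟩
  choose s hsc hsn hsℓ hse using hs
  let R : K → ℕ → K → Prop := fun k n k' ↦ ∃ h : G k, s ⟨k, h⟩ n = k'
  obtain ⟨τ, h1, h2, h3, h4, h5⟩ := Cone.exists_topology (R := R) (e := e) (ℓ := ℓ) hz
    (by rintro k n _ ⟨h, rfl⟩; exact hsn ⟨k, h⟩ n)
    (by rintro k n _ ⟨h, rfl⟩; exact hse ⟨k, h⟩ n)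
    (by rintro k n _ ⟨h, rfl⟩; exact hsℓ ⟨k, h⟩ n)
    (by rintro k n _ _ ⟨h, rfl⟩ ⟨h', rfl⟩; rfl)
  have hinj (g : α.ToType) (c : C) : Function.Injective fun i : ι ↦ ((g, c, i) : K) := by
    intro i j h
    simpa using h
  refine ⟨K, τ, ℓ, ⟨h1, h2, h3⟩, h4, fun k ↦ k.1.toOrd.2, hK, fun γ hγ ↦ ?_,
    fun β A hA hκA ↦ ?_⟩
  · obtain ⟨c, -, hcΛ, hc⟩ := exists_subset_mk_le_agree (fun x : ℕ → Λ ↦ x) Set.univ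
    let c' : C := ⟨c, hcΛ, by
      have : cl c = Set.univ := Set.eq_univ_of_forall fun x ↦ hc x trivial
      rw [this, mk_univ, hM]⟩
    rw [← hι]
    refine mk_le_of_injective
      (f := fun i : ι ↦ (⟨(ToType.mk ⟨γ, hγ⟩, c', i), ?_⟩ : {k : K | ℓ k = γ})) ?_
    · simp [ℓ]
    · exact fun i j h ↦ hinj _ _ (congrArg Subtype.val h)
  · obtain ⟨c, hcA, hcΛ, hc⟩ := exists_subset_mk_le_agree z A
    refine ⟨c, hcA, hcΛ, fun γ hγ ↦ ?_⟩
    have hγα : γ < α := by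
      have : #A ≠ 0 := fun h ↦ by
        rw [h] at hκA
        exact (aleph0_pos.trans_le (hωκ.trans hκA)).false
      obtain ⟨⟨k, hk⟩⟩ := mk_ne_zero_iff.1 this
      exact hγ.trans (hA k hk ▸ k.1.toOrd.2)
    let c' : C := ⟨z '' c, mk_image_le.trans hcΛ, by
      refine hκA.trans ?_
      rw [← mk_image_eq (s := A) hz]
      refine mk_le_mk_of_subset ?_
      rintro _ ⟨x, hx, rfl⟩ n
      obtain ⟨y, hy, h⟩ := hc x hx n
      exact ⟨z y, ⟨y, hy, rfl⟩, h⟩⟩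
    let g : α.ToType := ToType.mk ⟨γ, hγα⟩
    have hg (i : ι) : ℓ (g, c', i) = γ := by simp [ℓ, g]
    -- Since `#c ≤ #Λ < cf κ`, all of `c` is enumerated before some stage below `κ.ord`. The `κ`
    -- points `(g, c', i)` that come later satisfy `G`.
    let o : Ordinal.{u} := ⨆ x : c, e x
    have ho : o < κ.ord := iSup_lt_of_lt_cof (hcΛ.trans_lt hcof) fun x ↦ heκ x
    have ho1 : Order.succ o < κ.ord := (isSuccLimit_ord hωκ).succ_lt ho
    have hbig : κ ≤ #{i : ι | o < e (g, c', i)} := by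
      refine le_mk_setOf_of_mk_setOf_not_lt hωκ hι.ge ?_
      have := mk_setOf_lt_le (he.comp (hinj g c')) (Order.succ o)
      simp only [Function.comp_apply, Order.lt_succ_iff] at this
      simp only [not_lt]
      exact this.trans_lt (lt_ord.1 ho1)
    refine hbig.trans (mk_le_of_injective
      (f := fun i ↦ (⟨(g, c', i.1), ?_, hg i.1⟩ : {k : K | k ∈ closure c ∧ ℓ k = γ})) ?_)
    · have hG : G (g, c', i.1) := by
        rintro _ ⟨k', hk', rfl⟩
        refine ⟨k', rfl, ?_, ?_⟩
        · rw [hg, hA k' (hcA hk')]; exact hγ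
        · exact (Ordinal.le_iSup (fun x : c ↦ e x) ⟨k', hk'⟩).trans_lt i.2
      refine h5 _ _ fun n ↦ ⟨s ⟨_, hG⟩ n, ?_, hG, rfl⟩
      obtain ⟨x, hx, h⟩ := hsc ⟨_, hG⟩ n
      rwa [← hz h]
    · exact fun i j h ↦ Subtype.ext (hinj _ _ (congrArg Subtype.val h))

/-! ### Lower bound for the order type -/

theorem mk_level_inter_lt {K : Type u} [TopologicalSpace K] [T1Space K] {κ lam : Cardinal.{u}}
    (hκ : ℵ₀ ≤ κ) (hlam : lam < κ.ord.cof) {ℓ : K → Ordinal.{u}}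
    (hℓ : ∀ β, ∀ A : Set K, (∀ k ∈ A, ℓ k = β) → κ ≤ #A →
      ∃ c ⊆ A, #c ≤ lam ∧ ∀ γ < β, κ ≤ #{k | k ∈ closure c ∧ ℓ k = γ})
    {p : K → Ordinal.{u}} (hp : Function.Injective p) (hpc : ∀ x, IsClosed {y | p y < p x})
    (β : Ordinal.{u}) : #{k | ℓ k = β ∧ p k < κ.ord * β} < κ := by
  induction β using WellFoundedLT.induction with
  | ind β ih =>
  by_contra! hA
  obtain ⟨B, hBA, hκB, hB⟩ := exists_subset_forall_bounded hκ hlam p hA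
  obtain ⟨c, hcB, hcl, hc⟩ := hℓ β B (fun k hk ↦ (hBA hk).1) hκB
  obtain ⟨d, ⟨-, hd⟩, hcd⟩ := hB c hcB hcl
  obtain ⟨γ, hγ, r, hr, hdr⟩ := Ordinal.lt_mul_iff.1 hd
  have hclosure : closure c ⊆ {y | p y ≤ p d} := by
    refine closure_minimal hcd ?_
    convert (hpc d).union (isClosed_singleton (x := d)) using 1
    ext y
    simp [le_iff_lt_or_eq, hp.eq_iff, or_comm]
  have hr1 : Order.succ r < κ.ord := (isSuccLimit_ord hκ).succ_lt hr
  -- The closure of `c` stays at or below `p d = κ.ord * γ + r`, so its level `γ` part splits into a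
  -- piece small by induction and an interval of fewer than `κ` positions.
  have hsub : {k | k ∈ closure c ∧ ℓ k = γ} ⊆ {k | ℓ k = γ ∧ p k < κ.ord * γ} ∪
      {k | κ.ord * γ ≤ p k ∧ p k < κ.ord * γ + Order.succ r} := by
    rintro k ⟨hk, hkγ⟩
    rcases lt_or_ge (p k) (κ.ord * γ) with h | h
    · exact .inl ⟨hkγ, h⟩
    · refine .inr ⟨h, (hclosure hk).trans_lt ?_⟩
      rw [hdr]
      exact add_lt_add_right (Order.lt_succ r) _
  exact (hc γ hγ).not_gt <| (mk_le_mk_of_subset hsub).trans_lt <| (mk_union_le _ _).trans_lt <|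
    add_lt_of_lt hκ (ih γ hγ) ((mk_setOf_mem_Ico_le hp _ _).trans_lt (lt_ord.1 hr1))

theorem ord_mul_le_type {K : Type u} [TopologicalSpace K] [T1Space K] {κ lam : Cardinal.{u}}
    (hκ : ℵ₀ ≤ κ) (hlam : lam < κ.ord.cof) {ℓ : K → Ordinal.{u}} {α : Ordinal.{u}}
    (hα : ∀ γ < α, κ ≤ #{k | ℓ k = γ})
    (hℓ : ∀ β, ∀ A : Set K, (∀ k ∈ A, ℓ k = β) → κ ≤ #A →
      ∃ c ⊆ A, #c ≤ lam ∧ ∀ γ < β, κ ≤ #{k | k ∈ closure c ∧ ℓ k = γ})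
    {r : K → K → Prop} [IsWellOrder K r] (hr : ∀ x, IsClosed {y | r y x}) :
    κ.ord * α ≤ type r := by
  by_contra! h
  obtain ⟨γ, hγ, ξ, hξ, ho⟩ := Ordinal.lt_mul_iff.1 h
  have hp : Function.Injective (typein r) := typein_injective r
  have hlt := mk_level_inter_lt hκ hlam hℓ hp (by simpa using hr) γ
  have hsub : {k | ℓ k = γ} ⊆ {k | ℓ k = γ ∧ typein r k < κ.ord * γ} ∪
      {k | κ.ord * γ ≤ typein r k ∧ typein r k < κ.ord * γ + ξ} := by
    intro k hk
    rcases lt_or_ge (typein r k) (κ.ord * γ) with h | h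
    · exact .inl ⟨hk, h⟩
    · exact .inr ⟨h, ho ▸ typein_lt_type r k⟩
  exact (hα γ hγ).not_gt <| (mk_le_mk_of_subset hsub).trans_lt <| (mk_union_le _ _).trans_lt <|
    add_lt_of_lt hκ hlt ((mk_setOf_mem_Ico_le hp _ _).trans_lt (lt_ord.1 hξ))

/-! ### Upper bound and conclusion -/

theorem exists_isLeftSeparating_type_le {K : Type u} [TopologicalSpace K] {κ : Cardinal.{u}}
    (hK : #K ≤ κ) {ℓ : K → Ordinal.{u}} {α : Ordinal.{u}} (hα : ∀ k, ℓ k < α)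
    (hℓ : ∀ k, ∀ᶠ j in nhds k, j = k ∨ ℓ k < ℓ j) :
    ∃ (r : K → K → Prop) (h : IsLeftSeparating r),
      @Ordinal.type K r h.isWellOrder ≤ κ.ord * α := by
  obtain ⟨e, he, heκ⟩ := exists_injective_lt_ord hK
  let f : K → Ordinal.{u} := fun k ↦ κ.ord * ℓ k + e k
  have hf {k : K} {o : Ordinal.{u}} (h : ℓ k < o) : f k < κ.ord * o :=
    Ordinal.lt_mul_iff.2 ⟨_, h, _, heκ k, rfl⟩
  have hmono {k j : K} (h : ℓ k < ℓ j) : f k < f j := (hf h).trans_le le_self_add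
  have hinj : Function.Injective f := by
    intro k j h
    rcases lt_trichotomy (ℓ k) (ℓ j) with hl | hl | hl
    · exact ((hmono hl).ne h).elim
    · simp only [f, hl, add_right_inj] at h
      exact he h
    · exact ((hmono hl).ne' h).elim
  let g : K ↪ (κ.ord * α).ToType :=
    ⟨fun k ↦ ToType.mk ⟨f k, hf (hα k)⟩, fun k j h ↦
      hinj (congrArg Subtype.val (ToType.mk.injective h))⟩
  have hg (k j : K) : g k < g j ↔ f k < f j := ToType.mk.lt_iff_lt
  let φ := RelEmbedding.preimage g (· < ·)
  have hwo := φ.isWellOrder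
  refine ⟨_, ⟨hwo, fun x ↦ ?_⟩, ?_⟩
  · rw [← isOpen_compl_iff, isOpen_iff_mem_nhds]
    intro y hy
    filter_upwards [hℓ y] with j hj
    have hy : f x ≤ f y := not_lt.1 fun h ↦ hy ((hg y x).2 h)
    suffices f x ≤ f j from fun h ↦ this.not_gt ((hg j x).1 h)
    rcases hj with rfl | hj
    · exact hy
    · exact hy.trans (hmono hj).le
  · simpa using φ.ordinal_type_le

theorem theorem1p3 (κ : Cardinal.{u})
    (hκ : κ = 2 ^ ℵ₀ ∨ ∃ β : Ordinal.{u}, β.cof = ℵ₀ ∧ κ = ℶ_ (β + 1))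
    (α : Ordinal.{u}) (hα : α < (Order.succ κ).ord) :
    ∃ (X : Type u) (_ : TopologicalSpace X),
      LocallyCompactSpace X ∧ LocallyCountable X ∧ IsZeroDimensional X ∧
        IsLeftSeparated X ∧ leftSeparatingType X = κ.ord * α := by
  -- `λ` is `ℵ₀` or `ℶ_ β`; the latter is a strong limit of cofinality `ℵ₀`, whence `λ ^ ℵ₀ = 2 ^
  -- λ`.
  obtain ⟨lam, hlam, hκlam, hpow⟩ : ∃ lam : Cardinal.{u}, ℵ₀ ≤ lam ∧ κ = 2 ^ lam ∧
      lam ^ ℵ₀ = κ := by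
    rcases hκ with rfl | ⟨β, hβ, rfl⟩
    · exact ⟨ℵ₀, le_rfl, rfl, power_self_eq le_rfl⟩
    · have hlim : Order.IsSuccLimit β := one_lt_cof_iff.1 (hβ ▸ one_lt_aleph0)
      refine ⟨ℶ_ β, aleph0_le_beth β, beth_add_one β, ?_⟩
      have hs : IsStrongLimit (ℶ_ β) := isStrongLimit_beth.2 hlim.isSuccPrelimit
      have hcof : (ℶ_ β).ord.cof = ℵ₀ :=
        (cof_map_of_isNormal (isNormal_ord.comp isNormal_beth) hlim).trans hβ
      rw [beth_add_one, ← hs.power_cof_ord, hcof]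
  induction lam using Cardinal.inductionOn with | mk Λ
  have : Infinite Λ := infinite_iff.2 hlam
  have hωκ : ℵ₀ ≤ κ := hlam.trans (hκlam ▸ (cantor _).le)
  have hcof : #Λ < κ.ord.cof := hκlam ▸ lt_cof_ord_power hlam one_lt_two
  obtain ⟨X, τ, ℓ, ⟨h1, h2, h3⟩, h4, h5, h6, h7, h8⟩ :=
    exists_leveled_space hκlam hpow (Order.lt_succ_iff.1 (lt_ord.1 hα))
  obtain ⟨r, hr, hrα⟩ := exists_isLeftSeparating_type_le h6 h5 h4
  have := h3.t2
  refine ⟨X, τ, h1, h2, h3, ⟨r, hr⟩, le_antisymm ?_ ?_⟩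
  · have hmem : @Ordinal.type X r hr.isWellOrder ∈ leftSeparatingTypes X := ⟨r, hr, rfl⟩
    exact (csInf_le' hmem).trans hrα
  · refine le_csInf ⟨_, r, hr, rfl⟩ ?_
    rintro _ ⟨r', hr', rfl⟩
    have := hr'.isWellOrder
    exact ord_mul_le_type hωκ hcof h7 h8 hr'.isClosed_initial
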